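/- Let $N\ge 0$ be an integer, let $F_N$ be the free group of rank $N$, and let $\phi,\psi\in\mathrm{Aut}(F_N)$. Write $[\phi],[\psi]$ for the classes of $\phi,\psi$ in $\mathrm{Out}(F_N)=\mathrm{Aut}(F_N)/\mathrm{Inn}(F_N)$, and let $F_N\rtimes_\phi\mathbb Z$ denote the semidirect product in which $n\in\mathbb Z$ acts on $F_N$ by $\phi^n$ (similarly for $\psi$). If $F_N\rtimes_\phi\mathbb Z\cong F_N\rtimes_\psi\mathbb Z$ as abstract groups and $[\phi]$ has order $m\in\{1,2,3,\dots\}\cup\{\infty\}$ in $\mathrm{Out}(F_N)$, then $[\psi]$ also has order $m$ in $\mathrm{Out}(F_N)$. -/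

import Mathlib

/-- Inner automorphisms form a normal subgroup of the automorphism group. -/
instance innerAutNormal (G : Type*) [Group G] : (MulAut.conj (G := G)).range.Normal where
  conj_mem := by
    rintro _ ⟨g, rfl⟩ α
    refine ⟨α g, ?_⟩
    ext x
    simp [MulAut.conj_apply]

/-- The outer automorphism group `Out(G) = Aut(G) / Inn(G)`. -/
abbrev OuterAut (G : Type*) [Group G] : Type _ :=
  MulAut G ⧸ (MulAut.conj (G := G)).range

/-- The class `[φ]` of an automorphism `φ` in `Out(G)`. -/
def outerClass {G : Type*} [Group G] (φ : MulAut G) : OuterAut G :=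
  QuotientGroup.mk' (MulAut.conj (G := G)).range φ

/-- The semidirect product `G ⋊_φ ℤ`, in which `n : ℤ` acts on `G` by `φ ^ n`. -/
abbrev MappingTorusGroup {G : Type*} [Group G] (φ : MulAut G) : Type _ :=
  G ⋊[zpowersHom (MulAut G) φ] Multiplicative ℤ

/-! Let N ≥ 2 and Γ = F_N ⋊ ℤ. As F_N is centreless, the kernel of Γ → Out(F_N) is F_N · Z(Γ), so
F_N embeds in Γ/Z(Γ) with index the order of the outer class; that order is infinite iff Z(Γ) is
trivial. An isomorphism thus puts two copies of F_N in one group Γ/Z(Γ). If the indices are finite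
they agree: by Nielsen–Schreier (`FreeGroup.card_monoidHom_mul`), the intersection has the same
index in both copies. For N ≤ 1, the order divides 2, and it is 1 iff Γ is abelian. -/

/-! ### Free groups: centre and crossed homomorphisms -/

namespace FreeGroup

/-- A free group on at least two generators has trivial center. -/
theorem center_eq_bot {ι : Type*} [Nontrivial ι] : Subgroup.center (FreeGroup ι) = ⊥ := by
  classical
  rw [eq_bot_iff]
  intro w hw
  rw [Subgroup.mem_bot]
  by_contra hne
  obtain ⟨x, l, hxl⟩ : ∃ x l, w.toWord = x :: l :=
    List.exists_cons_of_ne_nil (by simpa using hne)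
  obtain ⟨a, ha⟩ := exists_ne x.1
  have hcomm : of a * w = w * of a := Subgroup.mem_center_iff.mp hw (of a)
  have hred : IsReduced ((a, true) :: x :: l) := by
    have := isReduced_toWord (x := w)
    rw [hxl] at this
    exact isReduced_cons_cons.mpr ⟨fun h => absurd h ha, this⟩
  have hleft : (of a * w).toWord = (a, true) :: x :: l := by
    rw [toWord_mul, toWord_of, hxl]
    exact hred.reduce_eq
  -- The words of `of a * w` and of `w` followed by `a` have equal length, so the sublist is
  -- everything and `w` would start with `a`.
  have hsub := toWord_mul_sublist w (of a)
  rw [← hcomm, hleft, hxl, toWord_of] at hsub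
  have heq := hsub.eq_of_length (by simp)
  simp only [List.cons_append, List.cons.injEq] at heq
  exact ha (congrArg Prod.fst heq.1)

/-- Crossed homomorphisms from a free group to the functions `X → A`, encoded as sections of the
semidirect product, correspond to arbitrary values on the generators. -/
noncomputable def sectionEquiv (ι X A : Type*) [MulAction (FreeGroup ι) X] [Group A] :
    {ρ : FreeGroup ι →* (X → A) ⋊[mulAutArrow] FreeGroup ι //
      SemidirectProduct.rightHom.comp ρ = MonoidHom.id _} ≃ (ι → X → A) where
  toFun ρ i := (ρ.1 (of i)).left
  invFun f := ⟨lift fun i => ⟨f i, of i⟩, by ext; simp⟩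
  left_inv ρ := by
    ext1
    ext1 i
    have h := DFunLike.congr_fun ρ.2 (of i)
    ext1
    · simp
    · simpa using h.symm
  right_inv f := by
    ext i
    simp

end FreeGroup

/-! ### Schreier cocycle and Shapiro's lemma -/

section CrossedHom

variable {G A : Type*} [Group G] [Group A] (H : Subgroup G)

/-- A choice of coset representatives which represents the trivial coset by `1`. -/
noncomputable def cosetRep (x : G ⧸ H) : G :=
  open scoped Classical in if x = (1 : G) then 1 else x.out

theorem cosetRep_one : cosetRep H ((1 : G) : G ⧸ H) = 1 := by
  simp [cosetRep]

theorem mk_cosetRep (x : G ⧸ H) : QuotientGroup.mk (cosetRep H x) = x := by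
  unfold cosetRep
  split_ifs with h
  · exact h.symm
  · exact Quotient.out_eq' x

theorem cosetRep_smul_one (x : G ⧸ H) : cosetRep H x • ((1 : G) : G ⧸ H) = x := by
  conv_rhs => rw [← mk_cosetRep H x]
  simp

theorem cosetRep_inv_smul (x : G ⧸ H) : (cosetRep H x)⁻¹ • x = ((1 : G) : G ⧸ H) := by
  rw [inv_smul_eq_iff, cosetRep_smul_one]

/-- The Schreier element measuring the failure of `g` to preserve coset representatives. -/
noncomputable def schreierElt (g : G) (x : G ⧸ H) : H :=
  ⟨(cosetRep H x)⁻¹ * g * cosetRep H (g⁻¹ • x), by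
    rw [mul_assoc, ← QuotientGroup.eq, mk_cosetRep, ← smul_eq_mul, ← MulAction.Quotient.smul_coe,
      mk_cosetRep, smul_inv_smul]⟩

/-- This cocycle identity makes the inverse map in `sectionEquivShapiro` multiplicative. -/
theorem schreierElt_mul (g h : G) (x : G ⧸ H) :
    schreierElt H (g * h) x = schreierElt H g x * schreierElt H h (g⁻¹ • x) := by
  ext
  simp [schreierElt, mul_smul, mul_assoc]

theorem schreierElt_coe_one (h : H) : schreierElt H (h : G) ((1 : G) : G ⧸ H) = h := by
  have : (h : G)⁻¹ • ((1 : G) : G ⧸ H) = ((1 : G) : G ⧸ H) := by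
    rw [MulAction.Quotient.smul_coe, QuotientGroup.eq]
    simp
  ext
  simp only [schreierElt, this, cosetRep_one]
  simp

theorem schreierElt_cosetRep (x : G ⧸ H) : schreierElt H (cosetRep H x) x = 1 := by
  ext
  simp [schreierElt, cosetRep_inv_smul, cosetRep_one]

theorem left_mul_apply {X : Type*} [MulAction G X]
    (a b : (X → A) ⋊[mulAutArrow] G) (x : X) :
    (a * b).left x = a.left x * b.left (a.right⁻¹ • x) := rfl

/-- A nonabelian form of Shapiro's lemma: a crossed homomorphism from `G` to the functions
`G ⧸ H → A` amounts to a homomorphism `H → A` and a function on the nontrivial cosets. -/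
noncomputable def sectionEquivShapiro :
    {ρ : G →* (G ⧸ H → A) ⋊[mulAutArrow] G //
      SemidirectProduct.rightHom.comp ρ = MonoidHom.id _} ≃
    (H →* A) × ({x : G ⧸ H // x ≠ ((1 : G) : G ⧸ H)} → A) := by
  classical
  let e (f : {x : G ⧸ H // x ≠ ((1 : G) : G ⧸ H)} → A) (x : G ⧸ H) : A :=
    if h : x = ((1 : G) : G ⧸ H) then 1 else f ⟨x, h⟩
  have e_one (f) : e f ((1 : G) : G ⧸ H) = 1 := by simp [e]
  have hr (ρ : {ρ : G →* (G ⧸ H → A) ⋊[mulAutArrow] G //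
      SemidirectProduct.rightHom.comp ρ = MonoidHom.id _}) (g : G) : (ρ.1 g).right = g :=
    DFunLike.congr_fun ρ.2 g
  have hfix (h : H) : (h : G)⁻¹ • ((1 : G) : G ⧸ H) = ((1 : G) : G ⧸ H) := by
    rw [MulAction.Quotient.smul_coe, QuotientGroup.eq]
    simp
  refine
    { toFun := fun ρ => ⟨MonoidHom.mk' (fun h => (ρ.1 (h : G)).left ((1 : G) : G ⧸ H)) ?_,
        fun x => (ρ.1 (cosetRep H x)).left x⟩
      invFun := fun p => ⟨MonoidHom.mk' (fun g =>
        ⟨fun x => e p.2 x * p.1 (schreierElt H g x) * (e p.2 (g⁻¹ • x))⁻¹, g⟩) ?_, ?_⟩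
      left_inv := ?_
      right_inv := ?_ }
  · intro a b
    simp only [Subgroup.coe_mul, map_mul, left_mul_apply, hr, hfix]
  · intro g h
    ext x
    · rw [left_mul_apply]
      simp [schreierElt_mul, mul_smul, mul_assoc]
    · rfl
  · rfl
  · intro ρ
    have he (x : G ⧸ H) : e (fun x => (ρ.1 (cosetRep H x)).left x) x =
        (ρ.1 (cosetRep H x)).left x := by
      by_cases h : x = ((1 : G) : G ⧸ H)
      · have h1 : e (fun x => (ρ.1 (cosetRep H x)).left x) x = 1 := by simp [e, h]
        rw [h1, h, cosetRep_one, map_one]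
        rfl
      · simp [e, h]
    ext g x
    · simp only [MonoidHom.mk'_apply, he]
      rw [mul_inv_eq_iff_eq_mul]
      -- Two expansions of ρ at one element: `cosetRep x * schreierElt g x = g * cosetRep (g⁻¹ •
      -- x)`.
      have h1 := left_mul_apply (ρ.1 (cosetRep H x)) (ρ.1 (schreierElt H g x : G)) x
      have h2 := left_mul_apply (ρ.1 g) (ρ.1 (cosetRep H (g⁻¹ • x))) x
      rw [← map_mul, hr] at h1 h2
      rw [cosetRep_inv_smul] at h1
      rw [← h1, ← h2]
      simp [schreierElt, mul_assoc]
    · exact (hr ρ g).symm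
  · rintro ⟨θ, f⟩
    ext x
    · simp [e_one, hfix, schreierElt_coe_one]
    · simp only [MonoidHom.mk'_apply, cosetRep_inv_smul, e_one, schreierElt_cosetRep]
      simp [e, x.2]

end CrossedHom

/-! ### Index formula and comparison of indices -/

/-- The Nielsen–Schreier index formula, expressed by counting homomorphisms to a finite group. -/
theorem FreeGroup.card_monoidHom_mul {ι A : Type*} [Finite ι] [Group A] [Finite A]
    (H : Subgroup (FreeGroup ι)) (hH : H.index ≠ 0) :
    Nat.card (H →* A) * Nat.card A ^ (H.index - 1) = Nat.card A ^ (H.index * Nat.card ι) := by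
  classical
  have : Finite (FreeGroup ι ⧸ H) := (Nat.card_ne_zero.mp hH).2
  have h := Nat.card_congr
    ((sectionEquivShapiro (A := A) H).symm.trans (sectionEquiv ι (FreeGroup ι ⧸ H) A))
  have hX : Nat.card {x : FreeGroup ι ⧸ H // x ≠ ((1 : FreeGroup ι) : FreeGroup ι ⧸ H)} =
      H.index - 1 := by
    cases nonempty_fintype (FreeGroup ι ⧸ H)
    rw [Subgroup.index_eq_card, Nat.card_eq_fintype_card, Nat.card_eq_fintype_card,
      Fintype.card_subtype_compl, Fintype.card_subtype_eq]
  rw [Nat.card_prod, Nat.card_fun, Nat.card_fun, Nat.card_fun, hX, ← pow_mul,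
    ← Subgroup.index_eq_card] at h
  exact h

/-- Two finite-index subgroups of a group that are free of the same finite rank at least two
have the same index. -/
theorem FreeGroup.index_range_eq {ι Q : Type*} [Finite ι] [Nontrivial ι] [Group Q]
    {i j : FreeGroup ι →* Q} (hi : Function.Injective i) (hj : Function.Injective j)
    (hi0 : i.range.index ≠ 0) (hj0 : j.range.index ≠ 0) : i.range.index = j.range.index := by
  set L : Subgroup Q := i.range ⊓ j.range
  have hL : L.index ≠ 0 := Subgroup.index_inf_ne_zero hi0 hj0
  have hLi : (L.comap i).index * i.range.index = L.index := by
    rw [Subgroup.index_comap, Subgroup.relIndex_mul_index inf_le_left]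
  have hLj : (L.comap j).index * j.range.index = L.index := by
    rw [Subgroup.index_comap, Subgroup.relIndex_mul_index inf_le_right]
  have ei : L.comap i ≃* L := ((L.comap i).equivMapOfInjective i hi).trans
    (MulEquiv.subgroupCongr (Subgroup.map_comap_eq_self inf_le_left))
  have ej : L.comap j ≃* L := ((L.comap j).equivMapOfInjective j hj).trans
    (MulEquiv.subgroupCongr (Subgroup.map_comap_eq_self inf_le_right))
  have hki : (L.comap i).index ≠ 0 := fun h => hL (by rw [← hLi, h, zero_mul])
  have hkj : (L.comap j).index ≠ 0 := fun h => hL (by rw [← hLj, h, zero_mul])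
  have hcard : Nat.card (L.comap i →* Multiplicative (ZMod 2)) =
      Nat.card (L.comap j →* Multiplicative (ZMod 2)) :=
    Nat.card_congr ((ei.trans ej.symm).monoidHomCongrLeftEquiv)
  have h1 := FreeGroup.card_monoidHom_mul (A := Multiplicative (ZMod 2)) _ hki
  have h2 := FreeGroup.card_monoidHom_mul (A := Multiplicative (ZMod 2)) _ hkj
  have h2A : Nat.card (Multiplicative (ZMod 2)) = 2 := by simp
  rw [h2A] at h1 h2
  rw [hcard] at h1
  have hN : 1 < Nat.card ι := Finite.one_lt_card
  generalize (L.comap i).index = k at *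
  generalize (L.comap j).index = l at *
  have hkl : k = l := by
    -- Cross-multiplying eliminates the common number of homomorphisms; exponents then give (N - 1)k
    -- = (N - 1)l.
    have h3 : 2 ^ (k * Nat.card ι + (l - 1)) = 2 ^ (l * Nat.card ι + (k - 1)) := by
      rw [pow_add, pow_add, ← h1, ← h2]
      ring
    have h4 := Nat.pow_right_injective le_rfl h3
    obtain ⟨n, hn⟩ := Nat.exists_eq_add_of_le hN
    rw [hn] at h4
    obtain ⟨k, rfl⟩ := Nat.exists_eq_succ_of_ne_zero hki
    obtain ⟨l, rfl⟩ := Nat.exists_eq_succ_of_ne_zero hkj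
    simp only [Nat.succ_eq_add_one, Nat.add_sub_cancel] at h4
    have h5 : (n + 1) * k = (n + 1) * l := by linarith
    rw [Nat.eq_of_mul_eq_mul_left n.succ_pos h5]
  subst hkl
  exact Nat.eq_of_mul_eq_mul_left (Nat.pos_of_ne_zero hki) (hLi.trans hLj.symm)

/-! ### Mapping torus groups and their centres -/

namespace MappingTorusGroup

open SemidirectProduct

variable {G : Type*} [Group G] (φ : MulAut G)

/-- The homomorphism from the mapping torus group to `Out(G)` which kills `G` and sends the stable
letter to `[φ]`. -/
def toOuterAut : MappingTorusGroup φ →* OuterAut G :=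
  (zpowersHom (OuterAut G) (outerClass φ)).comp rightHom

theorem index_ker_toOuterAut : (toOuterAut φ).ker.index = orderOf (outerClass φ) := by
  have : (toOuterAut φ).range = Subgroup.zpowers (outerClass φ) := by
    rw [toOuterAut, MonoidHom.range_comp, MonoidHom.range_eq_top.mpr rightHom_surjective,
      ← MonoidHom.range_eq_map]
    rfl
  rw [Subgroup.index_ker, this, Nat.card_zpowers]

variable {φ}

theorem toOuterAut_eq_one_iff {g : MappingTorusGroup φ} :
    toOuterAut φ g = 1 ↔ ∃ u : G, ∀ x, g * inl x * g⁻¹ = inl (u * x * u⁻¹) := by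
  have key : toOuterAut φ g = (zpowersHom (MulAut G) φ g.right : OuterAut G) := by
    simp [toOuterAut, outerClass, zpowersHom_apply]
  have hconj (x : G) : g * inl x * g⁻¹ =
      inl (g.left * zpowersHom (MulAut G) φ g.right x * g.left⁻¹) := by
    ext <;> simp [mul_assoc]
  rw [key, QuotientGroup.eq_one_iff]
  constructor
  · rintro ⟨u, hu⟩
    refine ⟨g.left * u, fun x => ?_⟩
    rw [hconj, ← hu]
    simp [mul_assoc]
  · rintro ⟨u, hu⟩
    refine ⟨g.left⁻¹ * u, ?_⟩
    ext x
    have := inl_injective ((hconj x).symm.trans (hu x))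
    rw [mul_inv_eq_iff_eq_mul, ← eq_inv_mul_iff_mul_eq] at this
    rw [this]
    simp [mul_assoc]

theorem eq_one_of_commute_inl (hG : Subgroup.center G = ⊥) {x : G}
    (hx : ∀ y : G, (inl y * inl x : MappingTorusGroup φ) = inl x * inl y) : x = 1 := by
  have : x ∈ Subgroup.center G := by
    rw [Subgroup.mem_center_iff]
    intro y
    apply inl_injective (φ := zpowersHom (MulAut G) φ)
    simpa using hx y
  rwa [hG, Subgroup.mem_bot] at this

/-- An element of the mapping torus group of a centerless group that commutes with `G` is
central. -/
theorem mem_center_of_commute_inl (hG : Subgroup.center G = ⊥) {z : MappingTorusGroup φ}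
    (hz : ∀ x : G, inl x * z = z * inl x) : z ∈ Subgroup.center (MappingTorusGroup φ) := by
  rw [Subgroup.mem_center_iff]
  intro g
  -- The commutator lies in `G` because ℤ is abelian, and it centralises `G` because `G` is normal;
  -- hence it is trivial.
  obtain ⟨d, hd⟩ : g * z * g⁻¹ * z⁻¹ ∈ (inl : G →* MappingTorusGroup φ).range := by
    rw [range_inl_eq_ker_rightHom, MonoidHom.mem_ker]
    simp [mul_comm]
  have hz' (x : G) : Commute (inl x) z := hz x
  have hgz (x : G) : Commute (inl x) (g * z * g⁻¹) := by
    obtain ⟨y, hy⟩ : g⁻¹ * inl x * g ∈ (inl : G →* MappingTorusGroup φ).range := by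
      rw [range_inl_eq_ker_rightHom, MonoidHom.mem_ker]
      simp
    have h := (Commute.conj_iff g).mpr (hz' y)
    rw [hy] at h
    simpa [mul_assoc] using h
  have hd1 : d = 1 := eq_one_of_commute_inl (φ := φ) hG fun x => by
    rw [hd]
    exact (hgz x).mul_right (hz' x).inv_right
  rw [hd1, map_one] at hd
  rwa [eq_mul_inv_iff_mul_eq, one_mul, eq_mul_inv_iff_mul_eq, eq_comm] at hd

/-- If `g` acts on `G` as conjugation by `u`, then `u⁻¹ * g` centralises `G`, hence is central. -/
theorem ker_toOuterAut (hG : Subgroup.center G = ⊥) :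
    (toOuterAut φ).ker = inl.range ⊔ Subgroup.center (MappingTorusGroup φ) := by
  apply le_antisymm
  · intro g hg
    obtain ⟨u, hu⟩ := toOuterAut_eq_one_iff.mp hg
    rw [← mul_inv_cancel_left (inl u) g]
    refine Subgroup.mul_mem_sup ⟨u, rfl⟩ (mem_center_of_commute_inl hG fun x => ?_)
    have := hu x
    rw [mul_inv_eq_iff_eq_mul] at this
    rw [mul_assoc, this]
    simp [mul_assoc]
  · rw [sup_le_iff]
    constructor
    · rintro _ ⟨u, rfl⟩
      exact toOuterAut_eq_one_iff.mpr ⟨u, fun x => by simp⟩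
    · intro z hz
      refine toOuterAut_eq_one_iff.mpr ⟨1, fun x => ?_⟩
      rw [← Subgroup.mem_center_iff.mp hz]
      simp

theorem center_eq_bot_iff (hG : Subgroup.center G = ⊥) :
    Subgroup.center (MappingTorusGroup φ) = ⊥ ↔ orderOf (outerClass φ) = 0 := by
  have hker (n : ℤ) (x : G) : toOuterAut φ ⟨x, Multiplicative.ofAdd n⟩ = outerClass φ ^ n := by
    simp [toOuterAut, zpowersHom_apply]
  rw [orderOf_eq_zero_iff, isOfFinOrder_iff_zpow_eq_one]
  constructor
  · rintro hc ⟨n, hn0, hn⟩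
    rw [← hker n 1, ← MonoidHom.mem_ker, ker_toOuterAut hG, hc, sup_bot_eq] at hn
    obtain ⟨x, hx⟩ := hn
    exact hn0 (congrArg SemidirectProduct.right hx).symm
  · rw [eq_bot_iff]
    intro h z hz
    have hz1 : z ∈ (toOuterAut φ).ker := by
      rw [ker_toOuterAut hG]
      exact Subgroup.mem_sup_right hz
    obtain ⟨x, n⟩ := z
    have hn : n = 1 := by
      by_contra hn
      exact h ⟨n.toAdd, hn, (hker n.toAdd x).symm.trans hz1⟩
    subst hn
    have hx : x = 1 := eq_one_of_commute_inl (φ := φ) hG fun y =>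
      Subgroup.mem_center_iff.mp hz _
    rw [hx]
    rfl

variable {Γ : Type*} [Group Γ] (e : MappingTorusGroup φ ≃* Γ)

/-- The composite `G → G ⋊ ℤ ≃ Γ → Γ ⧸ center Γ`. -/
def toModCenter : G →* Γ ⧸ Subgroup.center Γ :=
  (QuotientGroup.mk' (Subgroup.center Γ)).comp (e.toMonoidHom.comp inl)

theorem toModCenter_injective (hG : Subgroup.center G = ⊥) :
    Function.Injective (toModCenter e) := by
  rw [injective_iff_map_eq_one]
  intro x hx
  have hx' : e (inl x) ∈ Subgroup.center Γ := (QuotientGroup.eq_one_iff _).mp hx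
  refine eq_one_of_commute_inl (φ := φ) hG fun y => e.injective ?_
  rw [map_mul, map_mul]
  exact Subgroup.mem_center_iff.mp hx' _

theorem comap_center :
    (Subgroup.center Γ).comap e.toMonoidHom = Subgroup.center (MappingTorusGroup φ) := by
  ext z
  simp only [Subgroup.mem_comap, Subgroup.mem_center_iff]
  rw [← e.forall_congr_right]
  simp [← map_mul]

/-- Pulled back to the mapping torus, the range becomes `G` times the centre, the kernel of
`toOuterAut`. Infinite index and infinite order are both recorded as 0. -/
theorem index_range_toModCenter (hG : Subgroup.center G = ⊥) :
    (toModCenter e).range.index = orderOf (outerClass φ) := by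
  have he : Function.Surjective e.toMonoidHom := e.surjective
  rw [← index_ker_toOuterAut, ker_toOuterAut hG, toModCenter, MonoidHom.range_comp,
    MonoidHom.range_comp,
    ← Subgroup.index_comap_of_surjective _ (QuotientGroup.mk'_surjective _),
    Subgroup.comap_map_eq, QuotientGroup.ker_mk', ← Subgroup.index_comap_of_surjective _ he,
    ← comap_center e, ← Subgroup.comap_sup_eq e.toMonoidHom _ _ he,
    Subgroup.comap_map_eq_self_of_injective e.injective]

theorem orderOf_outerClass_eq_one_iff (hG : ∀ a b : G, a * b = b * a) :
    orderOf (outerClass φ) = 1 ↔ ∀ a b : MappingTorusGroup φ, a * b = b * a := by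
  rw [orderOf_eq_one_iff]
  constructor
  · intro h
    obtain ⟨u, hu⟩ := (QuotientGroup.eq_one_iff φ).mp h
    have hφ : φ = 1 := by
      ext x
      rw [← hu, MulAut.conj_apply, hG u, mul_inv_cancel_right, MulAut.one_apply]
    subst hφ
    intro a b
    ext
    · simp [hG]
    · simp [mul_comm]
  · intro h
    have : toOuterAut φ (inr (Multiplicative.ofAdd 1)) = 1 :=
      toOuterAut_eq_one_iff.mpr ⟨1, fun x => by rw [h (inr _)]; simp⟩
    simpa [toOuterAut] using this

end MappingTorusGroup

/-! ### Rank at most one, and the conclusion -/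

theorem FreeGroup.mulAut_sq_eq_one {ι : Type*} [Subsingleton ι] (φ : MulAut (FreeGroup ι)) :
    φ ^ 2 = 1 := by
  rcases isEmpty_or_nonempty ι with h | h
  · exact Subsingleton.elim _ _
  · have := uniqueOfSubsingleton (Classical.arbitrary ι)
    -- The relevant `n` is `Nat.card` of an infinite cyclic group, which is 0, so the units are
    -- those of ℤ.
    have hunits (n : ℕ) (hn : n = 0) (u : (ZMod n)ˣ) : u ^ 2 = 1 := by
      subst hn
      exact Int.units_sq u
    apply (IsCyclic.mulAutMulEquiv (FreeGroup ι)).injective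
    rw [map_pow, hunits _ (Nat.card_eq_zero_of_infinite), MulEquiv.map_one]

theorem FreeGroup.mul_comm_of_subsingleton {ι : Type*} [Subsingleton ι] (a b : FreeGroup ι) :
    a * b = b * a := by
  rcases isEmpty_or_nonempty ι with h | h
  · exact Subsingleton.elim _ _
  · have := uniqueOfSubsingleton (Classical.arbitrary ι)
    exact mul_comm' a b

/-- If `F_N ⋊_φ ℤ ≅ F_N ⋊_ψ ℤ` and `[φ]` has order `m` in `Out(F_N)`, then so does `[ψ]`.
Infinite order is included, as the case `m = 0` of `orderOf`. -/
theorem mainTheorem10 (N : ℕ) (φ ψ : MulAut (FreeGroup (Fin N)))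
    (hiso : Nonempty (MappingTorusGroup φ ≃* MappingTorusGroup ψ))
    (m : ℕ) (hφ : orderOf (outerClass φ) = m) :
    orderOf (outerClass ψ) = m := by
  obtain ⟨e⟩ := hiso
  rw [← hφ]
  rcases subsingleton_or_nontrivial (Fin N) with h | h
  · have hcomm := FreeGroup.mul_comm_of_subsingleton (ι := Fin N)
    have hiff : orderOf (outerClass ψ) = 1 ↔ orderOf (outerClass φ) = 1 := by
      rw [MappingTorusGroup.orderOf_outerClass_eq_one_iff hcomm,
        MappingTorusGroup.orderOf_outerClass_eq_one_iff hcomm]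
      constructor
      · intro h a b
        apply e.injective
        rw [map_mul, map_mul, h]
      · intro h a b
        apply e.symm.injective
        rw [map_mul, map_mul, h]
    have hdvd (α : MulAut (FreeGroup (Fin N))) : orderOf (outerClass α) ∣ 2 := by
      rw [orderOf_dvd_iff_pow_eq_one, outerClass, ← map_pow, FreeGroup.mulAut_sq_eq_one, map_one]
    have h1 := (Nat.dvd_prime Nat.prime_two).mp (hdvd φ)
    have h2 := (Nat.dvd_prime Nat.prime_two).mp (hdvd ψ)
    omega
  · have hF := FreeGroup.center_eq_bot (ι := Fin N)
    have hzero : orderOf (outerClass ψ) = 0 ↔ orderOf (outerClass φ) = 0 := by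
      rw [← MappingTorusGroup.center_eq_bot_iff hF, ← MappingTorusGroup.center_eq_bot_iff hF,
        ← MappingTorusGroup.comap_center e,
        ← (Subgroup.comap_injective (f := e.toMonoidHom) e.surjective).eq_iff,
        MonoidHom.comap_bot, (MonoidHom.ker_eq_bot_iff e.toMonoidHom).mpr e.injective]
    by_cases h0 : orderOf (outerClass φ) = 0
    · rw [h0, hzero, h0]
    · rw [← MappingTorusGroup.index_range_toModCenter e hF,
        ← MappingTorusGroup.index_range_toModCenter (MulEquiv.refl _) hF]
      apply FreeGroup.index_range_eq (MappingTorusGroup.toModCenter_injective _ hF)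
        (MappingTorusGroup.toModCenter_injective _ hF)
      · rwa [MappingTorusGroup.index_range_toModCenter _ hF, Ne, hzero]
      · rwa [MappingTorusGroup.index_range_toModCenter _ hF]
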